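/- Let $P$ be a finite poset, $K$ a field, and $A=I(P,K)$ the incidence algebra, with basis $f_{xy}$ ($x\le y$ in $P$) and multiplication $f_{xy}f_{yz}=f_{xz}$, $f_{xy}f_{zt}=0$ for $y\ne z$. A (left) $A$-module is distributive if its lattice of submodules is distributive, and thin if it has a composition series in which no simple module occurs more than once up to isomorphism. A closed subposet of $P$ is a poset $(S,\le_S)$ with $S\subseteq P$ such that $x\le_S y$ implies $x\le y$, and such that $x\le_S y$ and $x\le a\le b\le y$ imply $a,b\in S$ and $a\le_S b$. Let $H^1(\Delta(S),K^*)$ be the first cohomology group, with coefficients in the multiplicative group $K^*$, of the simplicial realization $\Delta(S)$ of $(S,\le_S)$, whose $n$-simplices are the chains $s_0\le_S s_1\le_S\dots\le_S s_n$. Then an $A$-module is distributive if and only if it is thin, and the isomorphism classes of distributive (equivalently, thin) $A$-modules are in bijection with $$\bigsqcup_{(S,\le_S)\ \text{closed subposet of } P} H^1(\Delta(S),K^*).$$ More precisely, the class of $M$ corresponds to a pair $(S,c)$ in which $S$ is the support of $M$ (that is, $x\le_S y$ if and only if $x\le y$ and $f_{xy}M\ne 0$), and the pair $(S,[\alpha])$,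 for a 1-cocycle $\alpha$ on $\Delta(S)$, corresponds to the class of the module $M_{S,\alpha}$ with $K$-basis $(m_x)_{x\in S}$ on which $f_{xy}m_y=\alpha_{xy}m_x$ if $x\le_S y$, and all other products $f_{xy}m_z$ are zero. -/

import Mathlib

universe u v w

namespace IncidenceRep

/-! ### Cochains of the order complex -/

section Cohomology

variable (S : Type v) [PartialOrder S] (G : Type u) [CommGroup G]

/-- The `n`-simplices of the simplicial realization of a poset `S`:
chains `s₀ ≤ s₁ ≤ … ≤ sₙ`. -/
abbrev Simplex (n : ℕ) : Type v := Fin (n + 1) →o S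

variable {S} in
/-- The `i`-th face of a simplex: omit the `i`-th entry of the chain. -/
def Simplex.face {n : ℕ} (s : Simplex S (n + 1)) (i : Fin (n + 2)) : Simplex S n :=
  s.comp (Fin.succAboveOrderEmb i).toOrderHom

/-- The `n`-cochains with values in a (multiplicative) abelian group: functions on the basis of the
free abelian group of `n`-chains. -/
abbrev Cochain (n : ℕ) : Type max u v := Simplex S n → G

/-- The coboundary `(δ f)(s₀,…,sₙ₊₁) = ∏ᵢ f(s₀,…,ŝᵢ,…,sₙ₊₁)^((-1)^i)`. -/
def coboundary (n : ℕ) : Cochain S G n →* Cochain S G (n + 1) where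
  toFun f := fun s => ∏ i : Fin (n + 2), f (s.face i) ^ ((-1 : ℤ) ^ (i : ℕ))
  map_one' := by
    funext s
    simp
  map_mul' f g := by
    funext s
    simp [mul_zpow, Finset.prod_mul_distrib]

/-- The group `Z¹` of 1-cocycles. -/
abbrev Z1 : Subgroup (Cochain S G 1) := (coboundary S G 1).ker

/-- The group `B¹` of 1-coboundaries. -/
abbrev B1 : Subgroup (Cochain S G 1) := (coboundary S G 0).range

variable {S} in
/-- The 1-simplex `(x, y)` for `x ≤ y`. -/
def edge {x y : S} (h : x ≤ y) : Simplex S 1 where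
  toFun := ![x, y]
  monotone' := by
    intro i j hij
    fin_cases i <;> fin_cases j <;> simp_all

/-- Every 1-coboundary is a 1-cocycle. -/
theorem B1_le_Z1 : B1 S G ≤ Z1 S G := by
  rintro _ ⟨f, rfl⟩
  rw [MonoidHom.mem_ker]
  funext s
  have h1 : ∀ a b : Fin 1 →o S, a 0 = b 0 → a = b := by
    intro a b h
    ext i
    fin_cases i
    exact h
  have e0 : (s.face 0).face 0 = (s.face 1).face 0 := h1 _ _ rfl
  have e1 : (s.face 0).face 1 = (s.face 2).face 0 := h1 _ _ rfl
  have e2 : (s.face 1).face 1 = (s.face 2).face 1 := h1 _ _ rfl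
  simp [coboundary, Fin.prod_univ_succ] at *
  rw [e0, e1, e2]
  generalize f ((s.face 1).face 0) = a
  generalize f ((s.face 2).face 0) = b
  generalize f ((s.face 2).face 1) = c
  simp [mul_comm, mul_left_comm]

/-- The first cohomology group `H¹ = Z¹ / B¹` of the simplicial realization of `S`, with
coefficients in `G`. -/
abbrev H1 : Type max u v := Z1 S G ⧸ (B1 S G).subgroupOf (Z1 S G)

end Cohomology

/-! ### Closed subposets -/

/-- A subposet `(S, ≤_S)` of `P` (a subset with a partial order contained in that of `P`, but not
necessarily the induced one) which is closed under subintervals. The relation `le` is stored as a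
relation on `P` that holds between members of the subset only. -/
@[ext]
structure ClosedSubposet (P : Type v) [PartialOrder P] where
  carrier : Set P
  le : P → P → Prop
  mem_of_le : ∀ {x y : P}, le x y → x ∈ carrier ∧ y ∈ carrier
  le_refl : ∀ {x : P}, x ∈ carrier → le x x
  le_trans : ∀ {x y z : P}, le x y → le y z → le x z
  le_sub : ∀ {x y : P}, le x y → x ≤ y
  closed : ∀ {x y a b : P}, le x y → x ≤ a → a ≤ b → b ≤ y → le a b

namespace ClosedSubposet

variable {P : Type v} [PartialOrder P] (S : ClosedSubposet P)

/-- The set of elements of `S`, as a type of its own: it carries `≤_S`, not the order induced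
from `P`. -/
def Elem : Type v := {x : P // x ∈ S.carrier}

variable {S} in
/-- The underlying element of `P`. -/
def Elem.val (x : S.Elem) : P := Subtype.val x

instance : PartialOrder S.Elem where
  le x y := S.le x.val y.val
  le_refl x := S.le_refl x.2
  le_trans _ _ _ := S.le_trans
  le_antisymm _ _ h h' := Subtype.ext (le_antisymm (S.le_sub h) (S.le_sub h'))

noncomputable instance [Fintype P] : Fintype S.Elem :=
  have : Finite S.Elem := inferInstanceAs (Finite {x : P // x ∈ S.carrier})
  Fintype.ofFinite _

end ClosedSubposet

/-! ### Properties of representations -/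

/-- A module is distributive if its lattice of submodules is distributive. -/
def IsDistributive (A : Type u) [Ring A] (M : Type w) [AddCommGroup M] [Module A M] : Prop :=
  ∀ X Y Z : Submodule A M, X ⊓ (Y ⊔ Z) = (X ⊓ Y) ⊔ (X ⊓ Z)

/-- The `i`-th factor of a composition series of submodules. -/
abbrev factor {A : Type u} [Ring A] {M : Type w} [AddCommGroup M] [Module A M]
    (s : CompositionSeries (Submodule A M)) (i : Fin s.length) : Type w :=
  ↥(s i.succ) ⧸ (s i.castSucc).submoduleOf (s i.succ)

/-- A module is thin (squarefree) if it has a composition series (from `0` to `M`) in which no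
simple module occurs more than once as a factor, up to isomorphism. -/
def IsThin (A : Type u) [Ring A] (M : Type w) [AddCommGroup M] [Module A M] : Prop :=
  ∃ s : CompositionSeries (Submodule A M), s.head = ⊥ ∧ s.last = ⊤ ∧
    ∀ i j : Fin s.length, Nonempty (factor s i ≃ₗ[A] factor s j) → i = j

/-! ### Representations of incidence algebras -/

section Reps

variable {K : Type u} [Field K] {P : Type v} [PartialOrder P]

variable (K) in
/-- The basis element `f_{xy}` (`x ≤ y`) of the incidence algebra. -/
def basisElem [DecidableEq P] {x y : P} (h : x ≤ y) : IncidenceAlgebra K P where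
  toFun a b := if a = x ∧ b = y then 1 else 0
  eq_zero_of_not_le' a b hab := if_neg fun e => hab (by rw [e.1, e.2]; exact h)

/-- A 1-cocycle is multiplicative. -/
theorem Z1_mul {S : Type v} [PartialOrder S] {G : Type u} [CommGroup G] (α : Z1 S G) {x y z : S}
    (hxy : x ≤ y) (hyz : y ≤ z) :
    α.1 (edge hxy) * α.1 (edge hyz) = α.1 (edge (hxy.trans hyz)) := by
  let s : Simplex S 2 :=
    { toFun := ![x, y, z]
      monotone' := by
        intro i j hij
        have := hxy.trans hyz
        fin_cases i <;> fin_cases j <;> simp_all }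
  have h1 : ∀ a b : Fin 2 →o S, a 0 = b 0 → a 1 = b 1 → a = b := by
    intro a b h h'
    ext i
    fin_cases i
    · exact h
    · exact h'
  have e0 : s.face 0 = edge hyz := h1 _ _ rfl rfl
  have e1 : s.face 1 = edge (hxy.trans hyz) := h1 _ _ rfl rfl
  have e2 : s.face 2 = edge hxy := h1 _ _ rfl rfl
  have h := congrFun (MonoidHom.mem_ker.1 α.2) s
  simp [coboundary, Fin.prod_univ_succ] at h
  rw [e0, e1, e2] at h
  rw [mul_comm (α.1 (edge hyz)), mul_assoc] at h
  exact (inv_mul_eq_one.1 h).symm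

/-- A 1-cocycle is trivial on degenerate edges. -/
theorem Z1_refl {S : Type v} [PartialOrder S] {G : Type u} [CommGroup G] (α : Z1 S G) (x : S) :
    α.1 (edge (le_refl x)) = 1 := by
  have h := Z1_mul α (le_refl x) (le_refl x)
  exact mul_eq_left.1 h

/-- The space of the representation `M_{S,α}`: it has a basis `(m_x)` indexed by the elements `x`
of `S`. -/
def CocycleRep (S : ClosedSubposet P) (_α : Z1 S.Elem Kˣ) : Type max u v := S.Elem → K

namespace CocycleRep

variable {S : ClosedSubposet P} {α : Z1 S.Elem Kˣ}

instance : AddCommGroup (CocycleRep S α) := inferInstanceAs (AddCommGroup (S.Elem → K))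

@[ext]
theorem ext {m n : CocycleRep S α} (h : ∀ x : S.Elem, m x = n x) : m = n := funext h

theorem add_apply (m n : CocycleRep S α) (x : S.Elem) : (m + n) x = m x + n x := rfl

theorem zero_apply (x : S.Elem) : (0 : CocycleRep S α) x = 0 := rfl

variable [Fintype P]

open Classical in
/-- The action on `M_{S,α}`: `f_{xy} m_y = α_{xy} m_x` if `x ≤_S y`, and all the other products
`f_{xy} m_z` are zero. -/
noncomputable instance : SMul (IncidenceAlgebra K P) (CocycleRep S α) where
  smul g m := fun x : S.Elem =>
    ∑ y : S.Elem, if h : x ≤ y then g x.val y.val * (α.1 (edge h) : K) * m y else 0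

open Classical in
theorem smul_apply (g : IncidenceAlgebra K P) (m : CocycleRep S α) (x : S.Elem) :
    (g • m) x = ∑ y : S.Elem, if h : x ≤ y then g x.val y.val * (α.1 (edge h) : K) * m y else 0 :=
  rfl

variable [LocallyFiniteOrder P]

theorem mul_smul_aux (g h : IncidenceAlgebra K P) (m : CocycleRep S α) :
    (g * h) • m = g • h • m := by
  classical
  ext x
  simp only [smul_apply, Finset.mul_sum]
  have key : ∀ z : S.Elem, (if hz : x ≤ z then ∑ y : S.Elem, g x.val z.val * (α.1 (edge hz) : K) *
      (if hy : z ≤ y then h z.val y.val * (α.1 (edge hy) : K) * m y else 0) else 0) =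
      ∑ y : S.Elem, if hz : x ≤ z ∧ z ≤ y then g x.val z.val * h z.val y.val *
        (α.1 (edge (hz.1.trans hz.2)) : K) * m y else 0 := by
    intro z
    by_cases hz : x ≤ z
    · rw [dif_pos hz]
      refine Finset.sum_congr rfl fun y _ => ?_
      by_cases hy : z ≤ y
      · rw [dif_pos hy, dif_pos ⟨hz, hy⟩, ← Z1_mul α hz hy, Units.val_mul]
        ring
      · rw [dif_neg hy, dif_neg fun e => hy e.2, mul_zero]
    · rw [dif_neg hz]
      exact (Finset.sum_eq_zero fun y _ => dif_neg fun e => hz e.1).symm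
  rw [Finset.sum_congr rfl fun z _ => key z, Finset.sum_comm]
  refine Finset.sum_congr rfl fun y _ => ?_
  by_cases hxy : x ≤ y
  · rw [dif_pos hxy, IncidenceAlgebra.mul_apply, Finset.sum_mul, Finset.sum_mul]
    symm
    rw [← Finset.sum_filter_add_sum_filter_not Finset.univ (fun z : S.Elem => x ≤ z ∧ z ≤ y)]
    rw [Finset.sum_eq_zero (s := Finset.univ.filter fun z : S.Elem => ¬ (x ≤ z ∧ z ≤ y))
      (fun z hz => dif_neg (Finset.mem_filter.1 hz).2), add_zero]
    refine Finset.sum_bij (fun z _ => z.val) ?_ ?_ ?_ ?_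
    · intro z hz
      have := (Finset.mem_filter.1 hz).2
      exact Finset.mem_Icc.2 ⟨S.le_sub this.1, S.le_sub this.2⟩
    · intro a _ b _ hab
      exact Subtype.ext hab
    · intro z hz
      have hz' := Finset.mem_Icc.1 hz
      have h1 : S.le x.val z := S.closed hxy le_rfl hz'.1 hz'.2
      have h2 : S.le z y.val := S.closed hxy hz'.1 hz'.2 le_rfl
      exact ⟨⟨z, (S.mem_of_le h2).1⟩, Finset.mem_filter.2 ⟨Finset.mem_univ _, h1, h2⟩, rfl⟩
    · intro z hz
      rw [dif_pos (Finset.mem_filter.1 hz).2]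
  · rw [dif_neg hxy]
    symm
    refine Finset.sum_eq_zero fun z _ => ?_
    rw [dif_neg]
    rintro ⟨h1, h2⟩
    exact hxy (h1.trans h2)

/-- `M_{S,α}` is a representation of the incidence algebra. -/
noncomputable instance [DecidableEq P] : Module (IncidenceAlgebra K P) (CocycleRep S α) where
  one_smul m := by
    classical
    ext x
    rw [smul_apply, Finset.sum_eq_single x]
    · rw [dif_pos le_rfl, Z1_refl]
      simp
    · intro y _ hy
      have : x.val ≠ y.val := fun e => hy (Subtype.ext e.symm)
      simp [this]
    · simp
  mul_smul := mul_smul_aux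
  smul_zero g := by
    classical
    ext x
    simp [smul_apply, zero_apply]
  smul_add g m n := by
    classical
    ext x
    rw [add_apply, smul_apply, smul_apply, smul_apply, ← Finset.sum_add_distrib]
    refine Finset.sum_congr rfl fun y _ => ?_
    split_ifs
    · rw [add_apply, mul_add]
    · rw [add_zero]
  add_smul g h m := by
    classical
    ext x
    rw [add_apply, smul_apply, smul_apply, smul_apply, ← Finset.sum_add_distrib]
    refine Finset.sum_congr rfl fun y _ => ?_
    split_ifs
    · rw [IncidenceAlgebra.add_apply]
      ring
    · rw [add_zero]
  zero_smul m := by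
    classical
    ext x
    simp [smul_apply, zero_apply]

end CocycleRep

/-- Isomorphism of modules, as an equivalence relation on the distributive modules. -/
def distributiveSetoid (A : Type u) [Ring A] :
    Setoid {M : ModuleCat.{w} A // IsDistributive A M} where
  r M N := Nonempty (M.1 ≃ₗ[A] N.1)
  iseqv := ⟨fun _ => ⟨LinearEquiv.refl _ _⟩, fun ⟨e⟩ => ⟨e.symm⟩, fun ⟨e⟩ ⟨f⟩ => ⟨e.trans f⟩⟩

/-- The isomorphism classes of distributive representations of a ring (with spaces in the
universe `w`). -/
abbrev DistributiveClasses (A : Type u) [Ring A] : Type max u (w + 1) :=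
  Quotient (distributiveSetoid.{u, w} A)

/-- The isomorphism class of a distributive representation. -/
def isoClass {A : Type u} [Ring A] (M : Type w) [AddCommGroup M] [Module A M]
    (h : IsDistributive A M) : DistributiveClasses.{u, w} A :=
  Quotient.mk _ ⟨ModuleCat.of A M, h⟩

/-- The disjoint union of the groups `H¹(Δ(S), K*)` over the closed subposets `S` of `P`. -/
abbrev ClosedCohomology (K : Type u) [Field K] (P : Type v) [PartialOrder P] : Type max u v :=
  Σ S : ClosedSubposet P, H1 S.Elem Kˣ

end Reps

end IncidenceRep

/-! The orthogonal idempotents $f_{xx}$ sum to 1, so a module $M$, and each of its submodules, is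
the direct sum of its weight spaces $f_{xx}M$. The corner $f_{xx}Af_{yy}$ is the line $Kf_{xy}$, or
0 when $x\not\le y$. Distributivity and thinness are both equivalent to all weight spaces having
dimension at most 1 (`IsMultiplicityFree`). If $m,n$ are independent of the same weight, then $m$,
$n$ and $m+n$ generate submodules that violate the distributive law; conversely, with weight spaces
of dimension at most 1, a submodule is determined by its set of weights. For thinness, a simple
module has a single weight, which determines it up to isomorphism, so thinness bounds each weight
multiplicity by 1.

For the classification, choose a nonzero $m_x$ in each nonzero weight space. Then
$f_{xy}m_y=\alpha_{xy}m_x$. The pairs with $\alpha_{xy}\ne 0$ form a closed subposet,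
$f_{xy}f_{yz}=f_{xz}$ is the cocycle condition, and rescaling the $m_x$ changes $\alpha$ by a
coboundary (`nonempty_linearEquiv_cocycleRep`). Conversely the annihilator of $M_{S,\alpha}$
recovers $S$ (`eq_of_linearEquiv`), and an isomorphism over a fixed $S$ is a rescaling of the basis
(`exists_rescaling_of_linearEquiv`). -/

namespace IncidenceRep

/-! ### Idempotents and corners of the incidence algebra -/

section Algebra

variable {K : Type u} [Field K] {P : Type v} [PartialOrder P] [DecidableEq P]

theorem basisElem_apply {x y : P} (h : x ≤ y) (a b : P) :
    basisElem K h a b = if a = x ∧ b = y then 1 else 0 := rfl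

variable (K) in
/-- The idempotent `f_{xx}` of the incidence algebra. -/
abbrev idem (x : P) : IncidenceAlgebra K P := basisElem K (le_refl x)

variable [LocallyFiniteOrder P]

theorem idem_mul_apply (x : P) (g : IncidenceAlgebra K P) (a b : P) :
    (idem K x * g) a b = if a = x then g a b else 0 := by
  by_cases hab : a ≤ b
  · rw [IncidenceAlgebra.mul_apply, Finset.sum_eq_single a]
    · by_cases h : a = x <;> simp [basisElem_apply, h]
    · intro c _ hc
      rw [basisElem_apply, if_neg (fun e => hc (e.2.trans e.1.symm)), zero_mul]
    · simp [hab]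
  · rw [IncidenceAlgebra.apply_eq_zero_of_not_le hab, IncidenceAlgebra.apply_eq_zero_of_not_le hab]
    simp

theorem mul_idem_apply (y : P) (g : IncidenceAlgebra K P) (a b : P) :
    (g * idem K y) a b = if b = y then g a b else 0 := by
  by_cases hab : a ≤ b
  · rw [IncidenceAlgebra.mul_apply, Finset.sum_eq_single b]
    · by_cases h : b = y <;> simp [basisElem_apply, h]
    · intro c _ hc
      rw [basisElem_apply, if_neg (fun e => hc (e.1.trans e.2.symm)), mul_zero]
    · simp [hab]
  · rw [IncidenceAlgebra.apply_eq_zero_of_not_le hab, IncidenceAlgebra.apply_eq_zero_of_not_le hab]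
    simp

/-- Only the $(x,y)$ entry survives both projections. Corners are thus at most one-dimensional,
which lets scalars replace algebra elements on weight vectors. -/
theorem idem_mul_mul_idem {x y : P} (h : x ≤ y) (g : IncidenceAlgebra K P) :
    idem K x * g * idem K y = g x y • basisElem K h := by
  ext a b _
  rw [mul_idem_apply, idem_mul_apply, IncidenceAlgebra.constSMul_apply, basisElem_apply]
  by_cases ha : a = x <;> by_cases hb : b = y <;> simp [ha, hb]

theorem idem_mul_mul_idem_of_not_le {x y : P} (h : ¬ x ≤ y) (g : IncidenceAlgebra K P) :
    idem K x * g * idem K y = 0 := by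
  ext a b _
  rw [mul_idem_apply, idem_mul_apply]
  by_cases ha : a = x <;> by_cases hb : b = y <;>
    simp [ha, hb, IncidenceAlgebra.apply_eq_zero_of_not_le h]

theorem idem_mul_basisElem {x y : P} (h : x ≤ y) : idem K x * basisElem K h = basisElem K h := by
  ext a b _
  rw [idem_mul_apply, basisElem_apply]
  by_cases ha : a = x <;> simp [ha]

theorem basisElem_mul_idem {x y : P} (h : x ≤ y) : basisElem K h * idem K y = basisElem K h := by
  ext a b _
  rw [mul_idem_apply, basisElem_apply]
  by_cases hb : b = y <;> simp [hb]

theorem idem_mul_idem_of_ne {x y : P} (h : x ≠ y) : idem K x * idem K y = 0 := by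
  ext a b _
  rw [idem_mul_apply, basisElem_apply]
  by_cases ha : a = x <;> simp [ha, h]

theorem basisElem_mul_basisElem {x y z : P} (hxy : x ≤ y) (hyz : y ≤ z) :
    basisElem K hxy * basisElem K hyz = basisElem K (hxy.trans hyz) := by
  ext a b hab
  rw [IncidenceAlgebra.mul_apply]
  by_cases h : a = x ∧ b = z
  · obtain ⟨rfl, rfl⟩ := h
    rw [Finset.sum_eq_single y]
    · simp [basisElem_apply]
    · intro c _ hc
      simp [basisElem_apply, hc]
    · simp [hxy, hyz]
  · rw [basisElem_apply, if_neg h]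
    refine Finset.sum_eq_zero fun c _ => ?_
    rw [basisElem_apply, basisElem_apply]
    by_cases ha : a = x
    · have hb : b ≠ z := fun hb => h ⟨ha, hb⟩
      simp [hb]
    · simp [ha]

omit [LocallyFiniteOrder P] in
theorem sum_idem [Fintype P] : ∑ x : P, idem K x = 1 := by
  have key : ∀ (s : Finset P) (a b : P),
      (∑ x ∈ s, idem K x) a b = ∑ x ∈ s, idem K x a b := by
    intro s a b
    induction s using Finset.induction_on with
    | empty => simp
    | insert x s hx ih =>
      rw [Finset.sum_insert hx, Finset.sum_insert hx, IncidenceAlgebra.add_apply, ih]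
  ext a b _
  rw [key, IncidenceAlgebra.one_apply, Finset.sum_eq_single a]
  · simp [basisElem_apply, eq_comm]
  · intro c _ hc
    rw [basisElem_apply, if_neg fun e => hc e.1.symm]
  · simp

end Algebra

/-! ### Weight spaces, and distributive = multiplicity-free = thin -/

section Weights

variable {K : Type u} [Field K] {P : Type v} [PartialOrder P] [DecidableEq P]
  [LocallyFiniteOrder P] {M : Type w} [AddCommGroup M] [Module (IncidenceAlgebra K P) M]

theorem idem_smul_basisElem_smul {x y : P} (h : x ≤ y) (m : M) :
    idem K x • basisElem K h • m = basisElem K h • m := by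
  rw [← mul_smul, idem_mul_basisElem]

theorem basisElem_smul_idem_smul {x y : P} (h : x ≤ y) (m : M) :
    basisElem K h • idem K y • m = basisElem K h • m := by
  rw [← mul_smul, basisElem_mul_idem]

theorem basisElem_smul_basisElem_smul {x y z : P} (hxy : x ≤ y) (hyz : y ≤ z) (m : M) :
    basisElem K hxy • basisElem K hyz • m = basisElem K (hxy.trans hyz) • m := by
  rw [← mul_smul, basisElem_mul_basisElem]

variable (K P) in
theorem sum_idem_smul [Fintype P] (m : M) : ∑ x : P, idem K x • m = m := by
  rw [← Finset.sum_smul, sum_idem, one_smul]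

variable (K P) in
theorem exists_idem_smul_notMem [Fintype P] (X : Submodule (IncidenceAlgebra K P) M) {m : M}
    (hm : m ∉ X) :
    ∃ x : P, idem K x • m ∉ X := by
  by_contra! h
  exact hm (sum_idem_smul K P m ▸ X.sum_mem fun x _ => h x)

variable (K P M) in
/-- Each weight space `f_{xx} M` is at most one-dimensional: any nonzero vector in it generates it
over the algebra. -/
def IsMultiplicityFree : Prop :=
  ∀ (x : P) (m n : M), idem K x • m = m → idem K x • n = n → m ≠ 0 →
    ∃ g : IncidenceAlgebra K P, n = g • m

theorem idem_smul_smul_of_not_le {x y : P} (h : ¬ x ≤ y) {m : M} (hm : idem K y • m = m)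
    (g : IncidenceAlgebra K P) :
    idem K x • g • m = 0 := by
  rw [← hm, ← mul_smul, ← mul_smul, idem_mul_mul_idem_of_not_le h, zero_smul]

section Scalars

variable [Module K M] [IsScalarTower K (IncidenceAlgebra K P) M]

theorem idem_smul_smul {x y : P} (h : x ≤ y) {m : M} (hm : idem K y • m = m)
    (g : IncidenceAlgebra K P) :
    idem K x • g • m = g x y • basisElem K h • m := by
  rw [← smul_assoc (g x y), ← idem_mul_mul_idem h, mul_smul, hm, mul_smul]

theorem idem_smul_smul_self {x : P} {m : M} (hm : idem K x • m = m) (g : IncidenceAlgebra K P) :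
    idem K x • g • m = g x x • m := by
  rw [idem_smul_smul le_rfl hm, hm]

theorem IsMultiplicityFree.exists_scalar (h : IsMultiplicityFree K P M) {x : P} {m n : M}
    (hm : idem K x • m = m) (hn : idem K x • n = n) (hm0 : m ≠ 0) : ∃ c : K, n = c • m := by
  obtain ⟨g, hg⟩ := h x m n hm hn hm0
  refine ⟨g x x, ?_⟩
  rw [← idem_smul_smul_self hm, ← hg, hn]

end Scalars

/-- Each weight component of $y+z\in X$ can be treated separately: if the component of $y$ vanishes,
it is that of $z$; otherwise it is a multiple of the component of $y$. -/
theorem IsMultiplicityFree.isDistributive [Fintype P] (h : IsMultiplicityFree K P M) :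
    IsDistributive (IncidenceAlgebra K P) M := by
  intro X Y Z
  refine le_antisymm ?_ le_inf_sup
  rintro m ⟨hX, hYZ⟩
  obtain ⟨y, hy, z, hz, rfl⟩ := Submodule.mem_sup.1 hYZ
  rw [← sum_idem_smul K P (y + z)]
  refine Submodule.sum_mem _ fun x _ => ?_
  have idem2 : ∀ m : M, idem K x • idem K x • m = idem K x • m :=
    fun m => idem_smul_basisElem_smul le_rfl m
  by_cases hy0 : idem K x • y = 0
  · refine (le_sup_right : X ⊓ Z ≤ _) ⟨X.smul_mem _ hX, ?_⟩
    rw [smul_add, hy0, zero_add]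
    exact Z.smul_mem _ hz
  · obtain ⟨g, hg⟩ := h x _ _ (idem2 y) (idem2 (y + z)) hy0
    refine (le_sup_left : X ⊓ Y ≤ _) ⟨X.smul_mem _ hX, ?_⟩
    rw [hg]
    exact Y.smul_mem _ (Y.smul_mem _ hy)

/-- The distributive law is tested on $m+n\in\langle m+n\rangle\cap(\langle m\rangle+\langle
n\rangle)$, which fails if $m,n$ are independent of the same weight. -/
theorem isMultiplicityFree_of_isDistributive_aux [Module K M]
    [IsScalarTower K (IncidenceAlgebra K P) M] (h : IsDistributive (IncidenceAlgebra K P) M) :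
    IsMultiplicityFree K P M := by
  intro x m n hm hn hm0
  have scal : ∀ c : K, c • m = (c • idem K x : IncidenceAlgebra K P) • m :=
    fun c => by rw [smul_assoc, hm]
  suffices ∃ c : K, n = c • m by
    obtain ⟨c, hc⟩ := this
    exact ⟨_, hc.trans (scal c)⟩
  have hmn : idem K x • (m + n) = m + n := by rw [smul_add, hm, hn]
  have hmem : m + n ∈ Submodule.span (IncidenceAlgebra K P) {m + n} ⊓
      (Submodule.span (IncidenceAlgebra K P) {m} ⊔
        Submodule.span (IncidenceAlgebra K P) {n}) :=
    ⟨Submodule.mem_span_singleton_self _,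
      Submodule.add_mem_sup (Submodule.mem_span_singleton_self _)
        (Submodule.mem_span_singleton_self _)⟩
  rw [h] at hmem
  obtain ⟨a, ⟨ha, ha'⟩, b, ⟨hb, hb'⟩, hab⟩ := Submodule.mem_sup.1 hmem
  obtain ⟨g, rfl⟩ := Submodule.mem_span_singleton.1 ha
  obtain ⟨g', hg⟩ := Submodule.mem_span_singleton.1 ha'
  obtain ⟨k, rfl⟩ := Submodule.mem_span_singleton.1 hb
  obtain ⟨k', hk⟩ := Submodule.mem_span_singleton.1 hb'
  -- Projecting to weight $x$ turns the coefficients into their diagonal entries: $c'm=c(m+n)$,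
  -- $d'n=d(m+n)$ and $(c+d)(m+n)=m+n$. A nonzero $c$ or $d$ makes $m,n$ proportional; if both
  -- vanish, $n=-m$.
  have e1 := congrArg (idem K x • ·) hg
  have e2 := congrArg (idem K x • ·) hk
  have e3 := congrArg (idem K x • ·) hab
  simp only [smul_add (idem K x), idem_smul_smul_self hm, idem_smul_smul_self hn,
    idem_smul_smul_self hmn] at e1 e2 e3
  rw [hm, hn] at e3
  generalize g x x = c at *
  generalize g' x x = c' at *
  generalize k x x = d at *
  generalize k' x x = d' at *
  by_cases hc : c = 0
  · by_cases hd : d = 0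
    · refine ⟨-1, ?_⟩
      simp only [hc, hd, zero_smul, add_zero] at e3
      rw [neg_smul, one_smul, eq_neg_iff_add_eq_zero, add_comm, ← e3]
    · have e4 : d • m = (d' - d) • n := by
        rw [sub_smul, e2, smul_add, add_sub_cancel_right]
      have hd' : d' - d ≠ 0 := by
        intro h0
        rw [h0, zero_smul] at e4
        exact (smul_ne_zero hd hm0) e4
      exact ⟨(d' - d)⁻¹ * d, by rw [mul_smul, e4, inv_smul_smul₀ hd']⟩
  · refine ⟨c⁻¹ * (c' - c), ?_⟩
    rw [mul_smul, sub_smul, e1, smul_add, add_sub_cancel_left, inv_smul_smul₀ hc]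

/-- An $A$-module carries a $K$-structure by restriction along $K\to A$; it is introduced only
inside proofs, so that the main statements need no compatible structure as a hypothesis. -/
theorem isScalarTower_compHom :
    letI : Module K M := Module.compHom M (algebraMap K (IncidenceAlgebra K P))
    IsScalarTower K (IncidenceAlgebra K P) M := by
  let _ : Module K M := Module.compHom M (algebraMap K (IncidenceAlgebra K P))
  refine ⟨fun c g m => ?_⟩
  rw [Algebra.smul_def, mul_smul]
  rfl

theorem IsDistributive.isMultiplicityFree (h : IsDistributive (IncidenceAlgebra K P) M) :
    IsMultiplicityFree K P M := by
  let _ : Module K M := Module.compHom M (algebraMap K (IncidenceAlgebra K P))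
  have : IsScalarTower K (IncidenceAlgebra K P) M := isScalarTower_compHom
  exact isMultiplicityFree_of_isDistributive_aux h

theorem isDistributive_iff_isMultiplicityFree [Fintype P] :
    IsDistributive (IncidenceAlgebra K P) M ↔ IsMultiplicityFree K P M :=
  ⟨IsDistributive.isMultiplicityFree, IsMultiplicityFree.isDistributive⟩

/-! ### Simple modules -/

section Simple

variable {T T' : Type w} [AddCommGroup T] [Module (IncidenceAlgebra K P) T]
  [AddCommGroup T'] [Module (IncidenceAlgebra K P) T']

/-- A simple module has one weight: a nonzero component of $gt$ at $y\ne x$ needs $y\le x$, and by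
simplicity it generates $t$ again, which needs $x\le y$. Hence $gt=g_{xx}t$, and the annihilator of
$t$ depends on $x$ alone. -/
theorem smul_eq_zero_iff_of_simple [IsSimpleModule (IncidenceAlgebra K P) T] {x : P} {t : T}
    (ht : idem K x • t = t)
    (ht0 : t ≠ 0) [Fintype P] (g : IncidenceAlgebra K P) : g • t = 0 ↔ g x x = 0 := by
  let _ : Module K T := Module.compHom T (algebraMap K (IncidenceAlgebra K P))
  have : IsScalarTower K (IncidenceAlgebra K P) T := isScalarTower_compHom
  have off : ∀ y, y ≠ x → idem K y • g • t = 0 := by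
    intro y hyx
    by_contra hne
    by_cases hy : y ≤ x
    · obtain ⟨k, hk⟩ := IsSimpleModule.toSpanSingleton_surjective (IncidenceAlgebra K P) hne t
      have : idem K x • k • idem K y • g • t = t := by
        have h2 : k • idem K y • g • t = t := hk
        rw [h2, ht]
      rw [idem_smul_smul_of_not_le (fun e => hyx (le_antisymm hy e))
        (idem_smul_basisElem_smul le_rfl _)] at this
      exact ht0 this.symm
    · exact hne (idem_smul_smul_of_not_le hy ht g)
  have : g • t = g x x • t := by
    rw [← sum_idem_smul K P (g • t), Finset.sum_eq_single x (fun y _ hy => off y hy) (by simp),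
      idem_smul_smul_self ht]
  rw [this, smul_eq_zero, or_iff_left ht0]

theorem nonempty_linearEquiv_of_simple [Fintype P] [IsSimpleModule (IncidenceAlgebra K P) T]
    [IsSimpleModule (IncidenceAlgebra K P) T']
    {x : P} {t : T} {t' : T'} (ht : idem K x • t = t) (ht0 : t ≠ 0) (ht' : idem K x • t' = t')
    (ht0' : t' ≠ 0) : Nonempty (T ≃ₗ[IncidenceAlgebra K P] T') := by
  have hker : (LinearMap.toSpanSingleton (IncidenceAlgebra K P) T t).ker =
      (LinearMap.toSpanSingleton (IncidenceAlgebra K P) T' t').ker := by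
    ext g
    rw [LinearMap.mem_ker, LinearMap.mem_ker, LinearMap.toSpanSingleton_apply,
      LinearMap.toSpanSingleton_apply, smul_eq_zero_iff_of_simple ht ht0,
      smul_eq_zero_iff_of_simple ht' ht0']
  exact ⟨(LinearMap.quotKerEquivOfSurjective _
      (IsSimpleModule.toSpanSingleton_surjective (IncidenceAlgebra K P) ht0)).symm.trans
    ((Submodule.quotEquivOfEq _ _ hker).trans (LinearMap.quotKerEquivOfSurjective _
      (IsSimpleModule.toSpanSingleton_surjective (IncidenceAlgebra K P) ht0')))⟩

end Simple

/-! ### Composition series -/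

theorem isSimpleModule_factor {R : Type u} [Ring R] {M : Type w} [AddCommGroup M] [Module R M]
    (s : CompositionSeries (Submodule R M)) (i : Fin s.length) : IsSimpleModule R (factor s i) :=
  (covBy_iff_quot_is_simple (s.step i).1.le).1 (s.step i)

/-- The class in the `i`-th factor of an element of the `i`-th submodule. -/
def toFactor {R : Type u} [Ring R] {M : Type w} [AddCommGroup M] [Module R M]
    (s : CompositionSeries (Submodule R M)) (i : Fin s.length) : s i.succ →ₗ[R] factor s i :=
  Submodule.mkQ _

theorem toFactor_eq_zero_iff {R : Type u} [Ring R] {M : Type w} [AddCommGroup M] [Module R M]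
    (s : CompositionSeries (Submodule R M)) (i : Fin s.length) (m : s i.succ) :
    toFactor s i m = 0 ↔ (m : M) ∈ s i.castSucc :=
  (Submodule.Quotient.mk_eq_zero _).trans Iff.rfl

theorem exists_level {R : Type u} [Ring R] {M : Type w} [AddCommGroup M] [Module R M]
    (s : CompositionSeries (Submodule R M)) (h0 : s.head = ⊥) (h1 : s.last = ⊤) {m : M}
    (hm : m ≠ 0) : ∃ i : Fin s.length, m ∈ s i.succ ∧ m ∉ s i.castSucc := by
  by_contra! h
  have key : ∀ i : Fin (s.length + 1), m ∉ s i := by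
    intro i
    induction i using Fin.induction with
    | zero =>
      change m ∉ s.head
      rwa [h0, Submodule.mem_bot]
    | succ i ih => exact fun hi => ih (h i hi)
  apply key (Fin.last _)
  change m ∈ s.last
  rw [h1]
  trivial

/-- A nonzero vector of weight $x$ enters the series at some level and gives that factor the weight
$x$. Factors sharing a weight are isomorphic, so by thinness all nonzero vectors of weight $x$ enter
at the same level. -/
theorem IsThin.isMultiplicityFree [Fintype P] (h : IsThin (IncidenceAlgebra K P) M) :
    IsMultiplicityFree K P M := by
  obtain ⟨s, h0, h1, hs⟩ := h
  intro x m n hm hn hm0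
  have uniq : ∀ (i j : Fin s.length) (a b : M), idem K x • a = a → idem K x • b = b →
      a ∈ s i.succ → a ∉ s i.castSucc → b ∈ s j.succ → b ∉ s j.castSucc → i = j := by
    intro i j a b ha hb hai hai' hbj hbj'
    have := isSimpleModule_factor s i
    have := isSimpleModule_factor s j
    refine hs i j (nonempty_linearEquiv_of_simple (x := x) (t := toFactor s i ⟨a, hai⟩)
      (t' := toFactor s j ⟨b, hbj⟩) ?_ ?_ ?_ ?_)
    · rw [← map_smul]
      exact congrArg _ (Subtype.ext ha)
    · rwa [Ne, toFactor_eq_zero_iff]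
    · rw [← map_smul]
      exact congrArg _ (Subtype.ext hb)
    · rwa [Ne, toFactor_eq_zero_iff]
  obtain ⟨i, hi, hi'⟩ := exists_level s h0 h1 hm0
  by_cases hn0 : n = 0
  · exact ⟨0, by rw [hn0, zero_smul]⟩
  obtain ⟨j, hj, hj'⟩ := exists_level s h0 h1 hn0
  obtain rfl := uniq i j m n hm hn hi hi' hj hj'
  have := isSimpleModule_factor s i
  have hne : toFactor s i ⟨m, hi⟩ ≠ 0 := by rwa [Ne, toFactor_eq_zero_iff]
  obtain ⟨g, hg⟩ := IsSimpleModule.toSpanSingleton_surjective (IncidenceAlgebra K P) hne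
    (toFactor s i ⟨n, hj⟩)
  refine ⟨idem K x * g, ?_⟩
  rw [LinearMap.toSpanSingleton_apply, ← map_smul, ← sub_eq_zero, ← map_sub,
    toFactor_eq_zero_iff] at hg
  have hg' : g • m - n ∈ s i.castSucc := hg
  -- The weight-$x$ part of $gm-n$ lies strictly below the common level of entry, so it must vanish.
  by_contra hne'
  have hd : idem K x • (g • m - n) ≠ 0 := by
    rw [smul_sub, hn, ← mul_smul]
    exact fun e => hne' (sub_eq_zero.1 e).symm
  obtain ⟨k, hk, hk'⟩ := exists_level s h0 h1 hd
  have hdi : idem K x • (g • m - n) ∈ s i.castSucc := Submodule.smul_mem _ _ hg'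
  obtain rfl := uniq i k m _ hm (idem_smul_basisElem_smul le_rfl _) hi hi' hk hk'
  exact hk' hdi

/-- A submodule is determined by its weights: at a common weight, the component of any vector is a
multiple of a nonzero component taken from the other submodule. -/
theorem IsMultiplicityFree.finite_submodule [Fintype P] (h : IsMultiplicityFree K P M) :
    Finite (Submodule (IncidenceAlgebra K P) M) := by
  refine Finite.of_injective (β := Set P)
    (fun X => {x | ∃ m ∈ X, idem K x • m ≠ 0}) ?_
  have key : ∀ X Y : Submodule (IncidenceAlgebra K P) M, {x : P | ∃ m ∈ X, idem K x • m ≠ 0} ⊆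
      {x | ∃ m ∈ Y, idem K x • m ≠ 0} → X ≤ Y := by
    intro X Y hXY m hm
    by_contra hmY
    obtain ⟨x, hx⟩ := exists_idem_smul_notMem K P Y hmY
    obtain ⟨n, hn, hn0⟩ := hXY (a := x) ⟨m, hm, fun e => hx (e ▸ Y.zero_mem)⟩
    obtain ⟨g, hg⟩ := h x _ (idem K x • m) (idem_smul_basisElem_smul le_rfl n)
      (idem_smul_basisElem_smul le_rfl m) hn0
    exact hx (hg ▸ Y.smul_mem _ (Y.smul_mem _ hn))
  exact fun X Y hXY => le_antisymm (key X Y hXY.subset) (key Y X hXY.superset)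

/-- Finiteness of the submodule lattice gives a composition series. If factors $i<j$ were isomorphic
they would share a weight; the vector of that weight in factor $j$ would be a multiple of one
already present at level $i$, hence zero in factor $j$. -/
theorem IsMultiplicityFree.isThin [Fintype P] (h : IsMultiplicityFree K P M) :
    IsThin (IncidenceAlgebra K P) M := by
  have := h.finite_submodule
  have : IsNoetherian (IncidenceAlgebra K P) M := isNoetherian_iff'.2 inferInstance
  have : IsArtinian (IncidenceAlgebra K P) M := inferInstanceAs (WellFoundedLT _)
  obtain ⟨s, h0, h1⟩ := exists_compositionSeries_of_isNoetherian_isArtinian (IncidenceAlgebra K P) M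
  refine ⟨s, h0, h1, ?_⟩
  have key : ∀ i j : Fin s.length, Nonempty (factor s i ≃ₗ[IncidenceAlgebra K P] factor s j) →
      ¬ i < j := by
    rintro i j ⟨e⟩ hij
    obtain ⟨m, hm, hm'⟩ := SetLike.exists_of_lt (s.step i).1
    obtain ⟨x, hx⟩ := exists_idem_smul_notMem K P (s i.castSucc) hm'
    have hxi : idem K x • m ∈ s i.succ := Submodule.smul_mem _ _ hm
    set t := toFactor s i ⟨_, hxi⟩ with ht
    have ht0 : t ≠ 0 := by rwa [Ne, ht, toFactor_eq_zero_iff]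
    have htx : idem K x • t = t := by
      rw [ht, ← map_smul]
      exact congrArg _ (Subtype.ext (idem_smul_basisElem_smul le_rfl m))
    obtain ⟨n, hn⟩ := Submodule.mkQ_surjective _ (e t)
    have hn' : toFactor s j n = e t := hn
    have hxn : toFactor s j (idem K x • n) = e t := by
      rw [map_smul, hn', ← map_smul, htx]
    have hnj : ((idem K x • n : s j.succ) : M) ∉ s j.castSucc := by
      rw [← toFactor_eq_zero_iff, hxn]
      simpa using ht0
    obtain ⟨g, hg⟩ := h x _ (idem K x • (n : M)) (idem_smul_basisElem_smul le_rfl m)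
      (idem_smul_basisElem_smul le_rfl _) (fun e => hx (e ▸ Submodule.zero_mem _))
    have hle : s i.succ ≤ s j.castSucc :=
      s.strictMono.monotone (Fin.succ_le_castSucc_iff.2 hij)
    apply hnj
    change idem K x • (n : M) ∈ _
    rw [hg]
    exact hle (Submodule.smul_mem _ _ hxi)
  intro i j hij
  exact le_antisymm (not_lt.1 (key j i (hij.map LinearEquiv.symm))) (not_lt.1 (key i j hij))

theorem isDistributive_iff_isThin [Fintype P] :
    IsDistributive (IncidenceAlgebra K P) M ↔ IsThin (IncidenceAlgebra K P) M :=
  isDistributive_iff_isMultiplicityFree.trans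
    ⟨IsMultiplicityFree.isThin, IsThin.isMultiplicityFree⟩

end Weights

end IncidenceRep

namespace IncidenceRep

/-! ### Cocycles as functions on edges -/

section Cocycles

variable {S : Type v} [PartialOrder S] {G : Type u} [CommGroup G]

theorem Simplex.eq_edge (s : Simplex S 1) : s = edge (s.monotone (Fin.zero_le 1)) := by
  ext i
  fin_cases i <;> rfl

theorem coboundary_edge (f : Cochain S G 0) {x y : S} (h : x ≤ y) :
    coboundary S G 0 f (edge h) =
      f (OrderHom.const _ y) * (f (OrderHom.const _ x))⁻¹ := by
  have h1 : ∀ a b : Fin 1 →o S, a 0 = b 0 → a = b := by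
    intro a b h
    ext i
    fin_cases i
    exact h
  have e0 : (edge h).face 0 = OrderHom.const _ y := h1 _ _ rfl
  have e1 : (edge h).face 1 = OrderHom.const _ x := h1 _ _ rfl
  simp [coboundary, Fin.prod_univ_succ, e0, e1]

/-- The 1-cochain with given values on edges. -/
def edgeCochain (a : ∀ x y : S, x ≤ y → G) : Cochain S G 1 :=
  fun s => a (s 0) (s 1) (s.monotone (Fin.zero_le 1))

theorem edgeCochain_mem_Z1 (a : ∀ x y : S, x ≤ y → G)
    (ha : ∀ (x y z : S) (h : x ≤ y) (h' : y ≤ z), a x y h * a y z h' = a x z (h.trans h')) :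
    edgeCochain a ∈ Z1 S G := by
  rw [MonoidHom.mem_ker]
  funext s
  have h01 : s 0 ≤ s 1 := s.monotone (by decide)
  have h12 : s 1 ≤ s 2 := s.monotone (by decide)
  have e0 : edgeCochain a (s.face 0) = a (s 1) (s 2) h12 := rfl
  have e1 : edgeCochain a (s.face 1) = a (s 0) (s 2) (h01.trans h12) := rfl
  have e2 : edgeCochain a (s.face 2) = a (s 0) (s 1) h01 := rfl
  change ∏ i : Fin 3, edgeCochain a (s.face i) ^ ((-1 : ℤ) ^ (i : ℕ)) = 1
  rw [Fin.prod_univ_three, e0, e1, e2, ← ha _ _ _ h01 h12]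
  simp

/-- Two cocycles are cohomologous if and only if they differ by a rescaling of the vertices. -/
theorem mk_eq_mk_iff_exists_rescaling (α β : Z1 S G) :
    (QuotientGroup.mk α : H1 S G) = QuotientGroup.mk β ↔
      ∃ c : S → G, ∀ (x y : S) (h : x ≤ y), c y * β.1 (edge h) = α.1 (edge h) * c x := by
  rw [QuotientGroup.eq, Subgroup.mem_subgroupOf]
  constructor
  · rintro ⟨f, hf⟩
    -- The rescaling relation reads $\alpha^{-1}\beta=c_x/c_y$, whereas the coboundary of $f$ is
    -- $f_y/f_x$; hence the inverse.
    refine ⟨fun x => (f (OrderHom.const _ x))⁻¹, fun x y h => ?_⟩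
    have := congrFun hf (edge h)
    rw [coboundary_edge] at this
    have e : ((α⁻¹ * β : Z1 S G) : Cochain S G 1) (edge h) =
      (α.1 (edge h))⁻¹ * β.1 (edge h) := rfl
    rw [e, eq_inv_mul_iff_mul_eq] at this
    rw [← this, mul_left_comm, inv_mul_cancel_left]
  · rintro ⟨c, hc⟩
    refine ⟨fun s => (c (s 0))⁻¹, ?_⟩
    funext s
    rw [s.eq_edge]
    generalize s.monotone (Fin.zero_le 1) = h
    rw [coboundary_edge]
    change (c (s 1))⁻¹ * (c (s 0))⁻¹⁻¹ = (α.1 (edge h))⁻¹ * β.1 (edge h)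
    rw [inv_inv, inv_mul_eq_iff_eq_mul, mul_left_comm, eq_inv_mul_iff_mul_eq, hc]

end Cocycles

/-! ### The modules $M_{S,\alpha}$ and their isomorphisms -/

namespace CocycleRep

variable {K : Type u} [Field K] {P : Type v} [PartialOrder P]
  {S : ClosedSubposet P} {α β : Z1 S.Elem Kˣ}

open Classical in
variable (α) in
/-- The basis vector `m_x`. -/
noncomputable def basisVec (x : S.Elem) : CocycleRep S α := fun y => if y = x then 1 else 0

theorem basisVec_self (x : S.Elem) : basisVec α x x = 1 := if_pos rfl

theorem basisVec_of_ne {x y : S.Elem} (h : y ≠ x) : basisVec α x y = 0 := if_neg h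

theorem basisVec_ne_zero (x : S.Elem) : basisVec α x ≠ 0 := fun h =>
  one_ne_zero ((basisVec_self x).symm.trans (congrFun h x))

variable [Fintype P] [DecidableEq P]

theorem basisElem_smul_apply {x y : S.Elem} (h : x ≤ y) (m : CocycleRep S α) :
    (basisElem K (S.le_sub h) • m) x = α.1 (edge h) * m y := by
  classical
  rw [smul_apply, Finset.sum_eq_single y]
  · rw [dif_pos h, basisElem_apply, if_pos ⟨rfl, rfl⟩, one_mul]
  · intro z _ hz
    have : z.val ≠ y.val := fun e => hz (Subtype.ext e)
    simp [basisElem_apply, this]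
  · simp

theorem basisElem_smul_apply_of_ne {x y : P} (h : x ≤ y) (m : CocycleRep S α) {z : S.Elem}
    (hz : z.val ≠ x) : (basisElem K h • m) z = 0 := by
  classical
  rw [smul_apply]
  refine Finset.sum_eq_zero fun t _ => ?_
  simp [basisElem_apply, hz]

theorem smul_idem_smul_apply (k : K) (x : S.Elem) (m : CocycleRep S α) :
    ((k • idem K x.val) • m) x = k * m x := by
  classical
  rw [smul_apply, Finset.sum_eq_single x]
  · rw [dif_pos le_rfl, Z1_refl]
    simp [basisElem_apply]
  · intro y _ hy
    have : y.val ≠ x.val := fun e => hy (Subtype.ext e)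
    simp [basisElem_apply, this]
  · simp

theorem smul_idem_smul_apply_of_ne (k : K) {x z : S.Elem} (hz : z ≠ x) (m : CocycleRep S α) :
    ((k • idem K x.val) • m) z = 0 := by
  classical
  have hz' : z.val ≠ x.val := fun e => hz (Subtype.ext e)
  rw [smul_apply]
  refine Finset.sum_eq_zero fun y _ => ?_
  simp [basisElem_apply, hz']

theorem basisElem_smul_of_not_le {x y : P} (h : x ≤ y) (hS : ¬ S.le x y) (m : CocycleRep S α) :
    basisElem K h • m = 0 := by
  classical
  ext z
  rw [smul_apply, zero_apply]
  refine Finset.sum_eq_zero fun t _ => ?_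
  by_cases hzt : z ≤ t
  · rw [dif_pos hzt, basisElem_apply, if_neg, zero_mul, zero_mul]
    rintro ⟨rfl, rfl⟩
    exact hS hzt
  · rw [dif_neg hzt]

variable [LocallyFiniteOrder P]

omit [LocallyFiniteOrder P] in
theorem idem_smul_basisVec (x : S.Elem) : idem K x.val • basisVec α x = basisVec α x := by
  ext z
  by_cases hz : z = x
  · subst hz
    rw [basisElem_smul_apply (le_refl z), Z1_refl, Units.val_one, one_mul]
  · have hz' : z.val ≠ x.val := fun e => hz (Subtype.ext e)
    rw [basisElem_smul_apply_of_ne _ _ hz', basisVec_of_ne hz]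

theorem isMultiplicityFree : IsMultiplicityFree K P (CocycleRep S α) := by
  intro x m n hm hn hm0
  have vanish : ∀ l : CocycleRep S α, idem K x • l = l → ∀ z : S.Elem, z.val ≠ x → l z = 0 :=
    fun l hl z hz => by rw [← hl, basisElem_smul_apply_of_ne _ _ hz]
  obtain ⟨z, hz⟩ : ∃ z, m z ≠ 0 := by
    by_contra! h
    exact hm0 (CocycleRep.ext h)
  have hzx : z.val = x := by
    by_contra h
    exact hz (vanish m hm z h)
  subst hzx
  refine ⟨(n z / m z) • idem K z.val, ?_⟩
  ext t
  by_cases ht : t = z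
  · rw [ht, smul_idem_smul_apply, div_mul_cancel₀ _ hz]
  · rw [smul_idem_smul_apply_of_ne _ ht]
    exact vanish n hn t fun e => ht (Subtype.ext e)

/-- If $x\le_S y$, then $f_{xy}m_y$ has the unit $\alpha_{xy}$ as its $x$-coordinate. The relation
$\le_S$ is thereby read off from an isomorphism invariant. -/
theorem basisElem_mem_annihilator_iff {x y : P} (h : x ≤ y) :
    basisElem K h ∈ Module.annihilator (IncidenceAlgebra K P) (CocycleRep S α) ↔ ¬ S.le x y := by
  rw [Module.mem_annihilator]
  refine ⟨fun h0 hS => ?_, fun hS => basisElem_smul_of_not_le h hS⟩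
  obtain ⟨hx, hy⟩ := S.mem_of_le hS
  let x' : S.Elem := ⟨x, hx⟩
  let y' : S.Elem := ⟨y, hy⟩
  have hle : x' ≤ y' := hS
  have key := basisElem_smul_apply (K := K) hle (basisVec α y')
  rw [basisVec_self, mul_one] at key
  exact Units.ne_zero (α.1 (edge hle)) (key.symm.trans (congrFun (h0 (basisVec α y')) x'))

/-- A rescaling of the basis vectors is an isomorphism of representations. -/
theorem nonempty_linearEquiv_of_rescaling (c : S.Elem → Kˣ)
    (hc : ∀ (x y : S.Elem) (h : x ≤ y), c y * β.1 (edge h) = α.1 (edge h) * c x) :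
    Nonempty (CocycleRep S α ≃ₗ[IncidenceAlgebra K P] CocycleRep S β) := by
  classical
  refine ⟨
    { toFun := fun m x => (c x : K) * m x
      invFun := fun m x => ((c x)⁻¹ : Kˣ) * m x
      map_add' := fun m n => by
        ext x
        exact mul_add _ _ _
      map_smul' := fun g m => ?_
      left_inv := fun m => funext fun x => Units.inv_mul_cancel_left _ _
      right_inv := fun m => funext fun x => Units.mul_inv_cancel_left _ _ }⟩
  ext x
  change (c x : K) * (g • m) x = ∑ y : S.Elem, _
  rw [smul_apply, Finset.mul_sum]
  refine Finset.sum_congr rfl fun y _ => ?_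
  by_cases h : x ≤ y
  · have := congrArg (fun u : Kˣ => (u : K)) (hc x y h)
    simp only [Units.val_mul] at this
    rw [dif_pos h, dif_pos h]
    linear_combination (-(g x.val y.val) * m y) * this
  · rw [dif_neg h, dif_neg h, mul_zero]

theorem eq_of_linearEquiv {S' : ClosedSubposet P} {β : Z1 S'.Elem Kˣ}
    (e : CocycleRep S α ≃ₗ[IncidenceAlgebra K P] CocycleRep S' β) : S = S' := by
  have hle : ∀ x y, S.le x y ↔ S'.le x y := by
    intro x y
    by_cases h : x ≤ y
    · rw [← not_iff_not, ← basisElem_mem_annihilator_iff (α := α) h,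
        ← basisElem_mem_annihilator_iff (α := β) h, e.annihilator_eq]
    · exact iff_of_false (fun hS => h (S.le_sub hS)) (fun hS => h (S'.le_sub hS))
  ext x y
  · exact ⟨fun hx => (S'.mem_of_le ((hle x x).1 (S.le_refl hx))).1,
      fun hx => (S.mem_of_le ((hle x x).2 (S'.le_refl hx))).1⟩
  · exact hle x y

/-- An isomorphism preserves weights, so it sends $m_x$ to $c_xm_x$ with $c_x\ne 0$; applying it to
$f_{xy}m_y=\alpha_{xy}m_x$ gives the relation. -/
theorem exists_rescaling_of_linearEquiv
    (e : CocycleRep S α ≃ₗ[IncidenceAlgebra K P] CocycleRep S β) :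
    ∃ c : S.Elem → Kˣ, ∀ (x y : S.Elem) (h : x ≤ y),
      c y * β.1 (edge h) = α.1 (edge h) * c x := by
  have weight : ∀ x, idem K x.val • e (basisVec α x) = e (basisVec α x) := fun x => by
    rw [← map_smul, idem_smul_basisVec]
  have hne : ∀ x, e (basisVec α x) x ≠ 0 := by
    intro x h0
    apply basisVec_ne_zero (α := α) x
    rw [← map_eq_zero_iff e e.injective]
    ext z
    by_cases hz : z = x
    · rw [hz, h0, zero_apply]
    · have hz' : z.val ≠ x.val := fun e => hz (Subtype.ext e)
      rw [← weight, basisElem_smul_apply_of_ne _ _ hz', zero_apply]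
  refine ⟨fun x => Units.mk0 _ (hne x), fun x y h => ?_⟩
  -- The scalar $\alpha_{xy}$ is written as the algebra element $\alpha_{xy}f_{xx}$, so that
  -- $A$-linearity of `e` applies to it.
  have hvec : basisElem K (S.le_sub h) • basisVec α y =
      ((α.1 (edge h) : K) • idem K x.val) • basisVec α x := by
    ext z
    by_cases hz : z = x
    · subst hz
      rw [basisElem_smul_apply h, smul_idem_smul_apply, basisVec_self, basisVec_self]
    · have hz' : z.val ≠ x.val := fun e => hz (Subtype.ext e)
      rw [basisElem_smul_apply_of_ne _ _ hz', smul_idem_smul_apply_of_ne _ hz]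
  have := congrFun (congrArg e hvec) x
  rw [map_smul, map_smul, basisElem_smul_apply h, smul_idem_smul_apply] at this
  ext
  rw [Units.val_mul, Units.val_mul, Units.val_mk0, Units.val_mk0, mul_comm, this]

end CocycleRep

end IncidenceRep

namespace IncidenceRep

/-! ### Support and structure constants of a multiplicity-free module -/

section Classification

variable {K : Type u} [Field K] {P : Type v} [PartialOrder P] [DecidableEq P]
  [LocallyFiniteOrder P] {M : Type w} [AddCommGroup M] [Module (IncidenceAlgebra K P) M]

namespace IsMultiplicityFree

/-- Since $n$ spans the weight space at $y$, $f_{xy}n=0$ would force $f_{xy}M=0$. This is what makes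
the support relation transitive. -/
theorem basisElem_smul_ne_zero (hM : IsMultiplicityFree K P M) {x y : P} (h : x ≤ y) {m n : M}
    (hm : basisElem K h • m ≠ 0) (hn : idem K y • n = n) (hn0 : n ≠ 0) :
    basisElem K h • n ≠ 0 := by
  intro h0
  let _ : Module K M := Module.compHom M (algebraMap K (IncidenceAlgebra K P))
  have : IsScalarTower K (IncidenceAlgebra K P) M := isScalarTower_compHom
  obtain ⟨g, hg⟩ := hM y n (idem K y • m) hn (idem_smul_basisElem_smul le_rfl m) hn0
  have e : idem K x • basisElem K h • g • n = (basisElem K h * g) x y • basisElem K h • n := by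
    rw [← mul_smul (basisElem K h), idem_smul_smul h hn]
  rw [← hg, basisElem_smul_idem_smul, idem_smul_basisElem_smul, h0, smul_zero] at e
  exact hm e

/-- The support of a representation whose weight spaces are at most one-dimensional. -/
def support (hM : IsMultiplicityFree K P M) : ClosedSubposet P where
  carrier := {x | ∃ m : M, idem K x • m ≠ 0}
  le x y := ∃ h : x ≤ y, ∃ m : M, basisElem K h • m ≠ 0
  mem_of_le := by
    rintro x y ⟨h, m, hm⟩
    refine ⟨⟨basisElem K h • m, by rwa [idem_smul_basisElem_smul]⟩, ⟨m, fun h0 => hm ?_⟩⟩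
    rw [← basisElem_smul_idem_smul, h0, smul_zero]
  le_refl := fun ⟨m, hm⟩ => ⟨le_rfl, m, hm⟩
  le_trans := by
    rintro x y z ⟨h, m, hm⟩ ⟨h', n, hn⟩
    refine ⟨h.trans h', n, ?_⟩
    rw [← basisElem_smul_basisElem_smul h h']
    exact hM.basisElem_smul_ne_zero h hm (idem_smul_basisElem_smul h' n) hn
  le_sub := fun ⟨h, _⟩ => h
  closed := by
    rintro x y a b ⟨h, m, hm⟩ hxa hab hby
    -- The factorization $f_{xy}=f_{xa}f_{ab}f_{by}$ shows that $f_{ab}$ cannot kill $f_{by}m$.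
    refine ⟨hab, basisElem K hby • m, fun h0 => hm ?_⟩
    rw [← basisElem_smul_basisElem_smul (hxa.trans hab) hby,
      ← basisElem_smul_basisElem_smul hxa hab, h0, smul_zero]

variable (hM : IsMultiplicityFree K P M)

theorem exists_weightVec (x : hM.support.Elem) : ∃ m : M, idem K x.val • m = m ∧ m ≠ 0 := by
  obtain ⟨m, hm⟩ := x.2
  exact ⟨_, idem_smul_basisElem_smul le_rfl m, hm⟩

/-- A nonzero vector of weight `x`, for `x` in the support. -/
noncomputable def weightVec (x : hM.support.Elem) : M := (hM.exists_weightVec x).choose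

theorem idem_smul_weightVec (x : hM.support.Elem) :
    idem K x.val • hM.weightVec x = hM.weightVec x := (hM.exists_weightVec x).choose_spec.1

theorem weightVec_ne_zero (x : hM.support.Elem) : hM.weightVec x ≠ 0 :=
  (hM.exists_weightVec x).choose_spec.2

theorem idem_smul_weightVec_of_ne {x : P} {y : hM.support.Elem} (h : x ≠ y.val) :
    idem K x • hM.weightVec y = 0 := by
  rw [← idem_smul_weightVec, ← mul_smul, idem_mul_idem_of_ne h, zero_smul]

theorem idem_smul_eq_zero {x : P} (hx : x ∉ hM.support.carrier) (m : M) : idem K x • m = 0 := by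
  by_contra h
  exact hx ⟨m, h⟩

theorem ext_idem [Fintype P] {m n : M}
    (h : ∀ x : hM.support.Elem, idem K x.val • m = idem K x.val • n) : m = n := by
  rw [← sum_idem_smul K P m, ← sum_idem_smul K P n]
  refine Finset.sum_congr rfl fun x _ => ?_
  by_cases hx : x ∈ hM.support.carrier
  · exact h ⟨x, hx⟩
  · rw [hM.idem_smul_eq_zero hx, hM.idem_smul_eq_zero hx]

variable [Module K M] [IsScalarTower K (IncidenceAlgebra K P) M]

theorem exists_structureConstant {x y : hM.support.Elem} (h : x ≤ y) :
    ∃ a : Kˣ, basisElem K (hM.support.le_sub h) • hM.weightVec y = (a : K) • hM.weightVec x := by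
  obtain ⟨h', m, hm⟩ := id h
  obtain ⟨c, hc⟩ := hM.exists_scalar (hM.idem_smul_weightVec x)
    (idem_smul_basisElem_smul h' (hM.weightVec y)) (hM.weightVec_ne_zero x)
  have hne := hM.basisElem_smul_ne_zero h' hm (hM.idem_smul_weightVec y) (hM.weightVec_ne_zero y)
  refine ⟨Units.mk0 c fun h0 => hne ?_, hc⟩
  rw [hc, h0, zero_smul]

/-- The scalar `a` with `f_{xy} m_y = a m_x`, where `m_x` and `m_y` are the chosen weight vectors.
-/
noncomputable def structureConstant (x y : hM.support.Elem) (h : x ≤ y) : Kˣ :=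
  (hM.exists_structureConstant h).choose

theorem basisElem_smul_weightVec {x y : hM.support.Elem} (h : x ≤ y) :
    basisElem K (hM.support.le_sub h) • hM.weightVec y =
      (hM.structureConstant x y h : K) • hM.weightVec x :=
  (hM.exists_structureConstant h).choose_spec

/-- Both sides are the coefficient of $m_x$ in $f_{xy}f_{yz}m_z=f_{xz}m_z$. -/
theorem structureConstant_mul (x y z : hM.support.Elem) (h : x ≤ y) (h' : y ≤ z) :
    hM.structureConstant x y h * hM.structureConstant y z h' =
      hM.structureConstant x z (h.trans h') := by
  ext
  apply smul_left_injective K (hM.weightVec_ne_zero x)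
  have : SMulCommClass K (IncidenceAlgebra K P) M := IsScalarTower.to_smulCommClass
  change _ • hM.weightVec x = _ • hM.weightVec x
  rw [← hM.basisElem_smul_weightVec (h.trans h'), Units.val_mul, mul_comm, mul_smul,
    ← hM.basisElem_smul_weightVec h, ← smul_comm, ← hM.basisElem_smul_weightVec h',
    basisElem_smul_basisElem_smul]

/-- The 1-cocycle formed by the structure constants. -/
noncomputable def cocycle : Z1 hM.support.Elem Kˣ :=
  ⟨edgeCochain hM.structureConstant, edgeCochain_mem_Z1 _ hM.structureConstant_mul⟩

variable [Fintype P]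

theorem idem_smul_sum_weightVec (m : CocycleRep hM.support hM.cocycle)
    (x : hM.support.Elem) :
    idem K x.val • ∑ y, m y • hM.weightVec y = m x • hM.weightVec x := by
  have : SMulCommClass K (IncidenceAlgebra K P) M := IsScalarTower.to_smulCommClass
  rw [Finset.smul_sum, Finset.sum_eq_single x]
  · rw [smul_comm, idem_smul_weightVec]
  · intro y _ hy
    have hy' : x.val ≠ y.val := fun e => hy (Subtype.ext e.symm)
    rw [smul_comm, idem_smul_weightVec_of_ne _ hy', smul_zero]
  · simp

/-- The representation attached to the structure constants maps isomorphically to the given one. -/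
theorem nonempty_linearEquiv_cocycleRep :
    Nonempty (M ≃ₗ[IncidenceAlgebra K P] CocycleRep hM.support hM.cocycle) := by
  classical
  have hcomm : SMulCommClass K (IncidenceAlgebra K P) M := IsScalarTower.to_smulCommClass
  let f : CocycleRep hM.support hM.cocycle →ₗ[IncidenceAlgebra K P] M :=
    { toFun := fun m => ∑ y, m y • hM.weightVec y
      map_add' := fun m n => by
        rw [← Finset.sum_add_distrib]
        exact Finset.sum_congr rfl fun y _ => add_smul _ _ _
      map_smul' := fun g m => by
        -- Linearity is checked on each weight component, where $g$ acts on $m_y$ through the single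
        -- entry $g_{xy}$; pairs outside $\le_S$ contribute zero on both sides.
        apply hM.ext_idem
        intro x
        rw [idem_smul_sum_weightVec, RingHom.id_apply, Finset.smul_sum, Finset.smul_sum,
          CocycleRep.smul_apply, Finset.sum_smul]
        refine Finset.sum_congr rfl fun y _ => ?_
        rw [smul_comm g, smul_comm (idem K x.val)]
        by_cases hxy : x.val ≤ y.val
        · rw [idem_smul_smul hxy (hM.idem_smul_weightVec y)]
          by_cases h : x ≤ y
          · rw [dif_pos h, hM.basisElem_smul_weightVec h, smul_smul, smul_smul, mul_comm (m y),
              mul_right_comm]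
            rfl
          · have h0 : basisElem K hxy • hM.weightVec y = 0 := by
              by_contra hne
              exact h ⟨hxy, _, hne⟩
            rw [dif_neg h, h0, zero_smul, smul_zero, smul_zero]
        · have h : ¬ x ≤ y := fun h => hxy (hM.support.le_sub h)
          rw [idem_smul_smul_of_not_le hxy (hM.idem_smul_weightVec y), dif_neg h, zero_smul,
            smul_zero] }
  have hf : ∀ m, f m = ∑ y, m y • hM.weightVec y := fun _ => rfl
  refine ⟨(LinearEquiv.ofBijective f ⟨?_, fun n => ?_⟩).symm⟩
  · rw [← LinearMap.ker_eq_bot, LinearMap.ker_eq_bot']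
    intro m hm
    ext x
    have := hM.idem_smul_sum_weightVec m x
    rw [← hf, hm, smul_zero] at this
    exact (smul_eq_zero.1 this.symm).resolve_right (hM.weightVec_ne_zero x)
  · have : ∀ x : hM.support.Elem, ∃ c : K, idem K x.val • n = c • hM.weightVec x := fun x =>
      hM.exists_scalar (hM.idem_smul_weightVec x) (idem_smul_basisElem_smul le_rfl n)
        (hM.weightVec_ne_zero x)
    choose c hc using this
    let m : CocycleRep hM.support hM.cocycle := c
    refine ⟨m, hM.ext_idem fun x => ?_⟩
    rw [hf, idem_smul_sum_weightVec, hc]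

end IsMultiplicityFree

theorem IsDistributive.exists_linearEquiv_cocycleRep [Fintype P]
    (h : IsDistributive (IncidenceAlgebra K P) M) :
    ∃ (S : ClosedSubposet P) (α : Z1 S.Elem Kˣ),
      Nonempty (M ≃ₗ[IncidenceAlgebra K P] CocycleRep S α) := by
  let _ : Module K M := Module.compHom M (algebraMap K (IncidenceAlgebra K P))
  have : IsScalarTower K (IncidenceAlgebra K P) M := isScalarTower_compHom
  exact ⟨_, _, h.isMultiplicityFree.nonempty_linearEquiv_cocycleRep⟩

end Classification

/-! ### The bijection with cohomology classes -/

section Bijection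

variable {K : Type u} [Field K] {P : Type v} [PartialOrder P] [Fintype P] [DecidableEq P]
  [LocallyFiniteOrder P]

theorem CocycleRep.isDistributive {S : ClosedSubposet P} (α : Z1 S.Elem Kˣ) :
    IsDistributive (IncidenceAlgebra K P) (CocycleRep S α) :=
  CocycleRep.isMultiplicityFree.isDistributive

theorem isoClass_eq_iff {A : Type u} [Ring A] {M N : Type w} [AddCommGroup M] [Module A M]
    [AddCommGroup N] [Module A N] (hM : IsDistributive A M) (hN : IsDistributive A N) :
    isoClass M hM = isoClass N hN ↔ Nonempty (M ≃ₗ[A] N) :=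
  Quotient.eq

theorem CocycleRep.nonempty_linearEquiv_iff {S : ClosedSubposet P} (α β : Z1 S.Elem Kˣ) :
    Nonempty (CocycleRep S α ≃ₗ[IncidenceAlgebra K P] CocycleRep S β) ↔
      (QuotientGroup.mk α : H1 S.Elem Kˣ) = QuotientGroup.mk β := by
  rw [mk_eq_mk_iff_exists_rescaling]
  exact ⟨fun ⟨e⟩ => CocycleRep.exists_rescaling_of_linearEquiv e,
    fun ⟨c, hc⟩ => CocycleRep.nonempty_linearEquiv_of_rescaling c hc⟩

/-- The isomorphism class of `M_{S,α}` depends only on the cohomology class of `α`. -/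
noncomputable def classOfCohomology (p : ClosedCohomology K P) :
    DistributiveClasses.{max u v, max u v} (IncidenceAlgebra K P) :=
  Quotient.lift (fun α : Z1 p.1.Elem Kˣ =>
      isoClass (CocycleRep p.1 α) (CocycleRep.isDistributive α))
    (fun α β h => (isoClass_eq_iff _ _).2
      ((CocycleRep.nonempty_linearEquiv_iff α β).2 (Quotient.sound h))) p.2

theorem classOfCohomology_mk (S : ClosedSubposet P) (α : Z1 S.Elem Kˣ) :
    classOfCohomology ⟨S, (QuotientGroup.mk α : H1 S.Elem Kˣ)⟩ =
      isoClass (CocycleRep S α) (CocycleRep.isDistributive α) := rfl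

theorem classOfCohomology_bijective : Function.Bijective (classOfCohomology (K := K) (P := P)) := by
  constructor
  · rintro ⟨S, a⟩ ⟨S', b⟩ h
    obtain ⟨α, rfl⟩ := QuotientGroup.mk_surjective a
    obtain ⟨β, rfl⟩ := QuotientGroup.mk_surjective b
    rw [classOfCohomology_mk, classOfCohomology_mk, isoClass_eq_iff] at h
    obtain rfl := h.elim CocycleRep.eq_of_linearEquiv
    rw [(CocycleRep.nonempty_linearEquiv_iff α β).1 h]
  · intro q
    obtain ⟨⟨M, hM⟩, rfl⟩ := Quotient.exists_rep q
    obtain ⟨S, α, ⟨e⟩⟩ := hM.exists_linearEquiv_cocycleRep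
    exact ⟨⟨S, QuotientGroup.mk α⟩, Quotient.sound ⟨e.symm⟩⟩

end Bijection

end IncidenceRep

theorem theorem5 {K : Type u} [Field K] {P : Type v} [PartialOrder P] [Fintype P]
    [DecidableEq P] [LocallyFiniteOrder P] :
    -- distributive and thin representations are the same
    (∀ (M : Type w) [AddCommGroup M] [Module (IncidenceAlgebra K P) M],
      IncidenceRep.IsDistributive (IncidenceAlgebra K P) M ↔
        IncidenceRep.IsThin (IncidenceAlgebra K P) M) ∧
    -- their isomorphism classes are in bijection with the disjoint union of the `H¹(Δ(S), K*)`;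
    -- the class of `M` goes to a pair `(S, c)` with `S` the support of `M`, and that of `M_{S,α}`
    -- goes to `(S, [α])`
    (∃ Φ : IncidenceRep.DistributiveClasses.{max u v, max u v} (IncidenceAlgebra K P) ≃
        IncidenceRep.ClosedCohomology K P,
      (∀ (M : Type max u v) [AddCommGroup M] [Module (IncidenceAlgebra K P) M]
        (hM : IncidenceRep.IsDistributive (IncidenceAlgebra K P) M) (x y : P),
        (Φ (IncidenceRep.isoClass M hM)).1.le x y ↔
          ∃ hxy : x ≤ y,
            IncidenceRep.basisElem K hxy ∉ Module.annihilator (IncidenceAlgebra K P) M) ∧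
      (∀ (S : IncidenceRep.ClosedSubposet P) (α : IncidenceRep.Z1 S.Elem Kˣ),
        ∃ h : IncidenceRep.IsDistributive (IncidenceAlgebra K P) (IncidenceRep.CocycleRep S α),
          Φ (IncidenceRep.isoClass (IncidenceRep.CocycleRep S α) h) =
            ⟨S, (QuotientGroup.mk α : IncidenceRep.H1 S.Elem Kˣ)⟩)) ∧
    -- no representation is missed because its space lies in another universe
    (∀ (M : Type w) [AddCommGroup M] [Module (IncidenceAlgebra K P) M],
      IncidenceRep.IsDistributive (IncidenceAlgebra K P) M →
        ∃ (S : IncidenceRep.ClosedSubposet P) (α : IncidenceRep.Z1 S.Elem Kˣ),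
          Nonempty (M ≃ₗ[IncidenceAlgebra K P] IncidenceRep.CocycleRep S α)) := by
  refine ⟨fun M _ _ => IncidenceRep.isDistributive_iff_isThin, ?_,
    fun M _ _ h => h.exists_linearEquiv_cocycleRep⟩
  let Φ := (Equiv.ofBijective _ (IncidenceRep.classOfCohomology_bijective (K := K) (P := P))).symm
  have hΦ : ∀ (S : IncidenceRep.ClosedSubposet P) (α : IncidenceRep.Z1 S.Elem Kˣ),
      Φ (IncidenceRep.isoClass (IncidenceRep.CocycleRep S α)
        (IncidenceRep.CocycleRep.isDistributive α)) =
          ⟨S, (QuotientGroup.mk α : IncidenceRep.H1 S.Elem Kˣ)⟩ := fun S α =>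
    (Equiv.symm_apply_eq _).2 (IncidenceRep.classOfCohomology_mk S α).symm
  refine ⟨Φ, fun M _ _ hM x y => ?_, fun S α => ⟨_, hΦ S α⟩⟩
  -- The annihilator is invariant under isomorphism, so the support can be computed on the model
  -- $M_{S,\alpha}$.
  obtain ⟨S, α, ⟨e⟩⟩ := hM.exists_linearEquiv_cocycleRep
  rw [(IncidenceRep.isoClass_eq_iff hM (IncidenceRep.CocycleRep.isDistributive α)).2 ⟨e⟩, hΦ,
    e.annihilator_eq]
  simp only [IncidenceRep.CocycleRep.basisElem_mem_annihilator_iff, not_not]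
  exact ⟨fun h => ⟨S.le_sub h, h⟩, fun ⟨_, h⟩ => h⟩
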